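/- For graphs $G_1,G_2$ on the vertex set $[n]=\{1,\dots,n\}$, let $G_1\oplus G_2$ be their symmetric difference, i.e. the graph on $[n]$ whose edges are those belonging to exactly one of $G_1,G_2$. For a fixed graph $H$, an $H$-code on $[n]$ is a collection of graphs on $[n]$ containing no two distinct members $G_1,G_2$ for which $G_1\oplus G_2$ is a copy of $H$ (that is, consists of a graph isomorphic to $H$ together with isolated vertices). Let $D_H(n)$ be the maximum cardinality of an $H$-code on $[n]$ and let $d_H(n)=D_H(n)/2^{\binom n2}$. Let $K_{1,t}$ be the star with $t$ edges and $M_t$ the matching with $t$ pairwise disjoint edges. Theorem. For every positive integer $k$, $$d_{K_{1,2k}}(n)=\Theta_k(1/n^k)\qquad\text{and}\qquad d_{M_{2k}}(n)=\Theta_k(1/n^k).$$ That is, for each $H\in\{K_{1,2k},M_{2k}\}$ there are constants $c,C>0$ depending only on $k$ and on which of the two graphs $H$ is, such that $c/n^k\le d_H(n)\le C/n^k$ for all integers $n\ge 1$. -/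

import Mathlib

open scoped symmDiff

/-- A collection `F` of graphs on the vertex set `V` is an `ℋ`-code if no two (distinct) members
of `F` have their symmetric difference in `ℋ`. Here `G₁ ∆ G₂` is the graph on `V` whose edges are
those that belong to exactly one of `G₁`, `G₂`. -/
def IsGraphCode {V : Type*} (ℋ : Set (SimpleGraph V)) (F : Finset (SimpleGraph V)) : Prop :=
  ∀ G₁ ∈ F, ∀ G₂ ∈ F, G₁ ≠ G₂ → G₁ ∆ G₂ ∉ ℋ

/-- `D_ℋ(n)`: the maximum cardinality of an `ℋ`-code, for a family `ℋ` of graphs on `[n]`. -/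
noncomputable def maxGraphCode {n : ℕ} (ℋ : Set (SimpleGraph (Fin n))) : ℕ :=
  sSup {m : ℕ | ∃ F : Finset (SimpleGraph (Fin n)), IsGraphCode ℋ F ∧ F.card = m}

/-- The supremum defining `maxGraphCode` is attained, so it is a maximum. -/
theorem isGreatest_maxGraphCode {n : ℕ} (ℋ : Set (SimpleGraph (Fin n))) :
    IsGreatest {m : ℕ | ∃ F : Finset (SimpleGraph (Fin n)), IsGraphCode ℋ F ∧ F.card = m}
      (maxGraphCode ℋ) := by
  classical
  have hb : BddAbove
      {m : ℕ | ∃ F : Finset (SimpleGraph (Fin n)), IsGraphCode ℋ F ∧ F.card = m} :=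
    ⟨Fintype.card (SimpleGraph (Fin n)), by rintro m ⟨F, -, rfl⟩; exact F.card_le_univ⟩
  exact ⟨Nat.sSup_mem ⟨0, ∅, by simp [IsGraphCode], rfl⟩ hb, fun m hm => le_csSup hb hm⟩

/-- All copies of `H` on the vertex set `V`: the images of `H` under injections of its vertex set
into `V` (the vertices of `V` outside the image are isolated). -/
def graphCopies {W : Type*} (H : SimpleGraph W) (V : Type*) : Set (SimpleGraph V) :=
  {G | ∃ f : W ↪ V, G = H.map f}

/-- `d_H(n)`: the maximum fraction of the `2 ^ (n choose 2)` graphs on `[n]` that lie in an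
`H`-code. -/
noncomputable def graphCodeDensity {W : Type*} (H : SimpleGraph W) (n : ℕ) : ℝ :=
  (maxGraphCode (graphCopies H (Fin n)) : ℝ) / 2 ^ n.choose 2

/-- The star `K_{1,t}` with `t` edges. -/
def starK (t : ℕ) : SimpleGraph (Fin 1 ⊕ Fin t) :=
  completeBipartiteGraph (Fin 1) (Fin t)

/-- The matching `M_t`: the vertices are the pairs `(i, j)` with `i < t` and `j < 2`, and the `t`
pairwise disjoint edges join `(i, 0)` to `(i, 1)`. -/
def matchingM (t : ℕ) : SimpleGraph (Fin t × Fin 2) where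
  Adj a b := a.1 = b.1 ∧ a.2 ≠ b.2
  symm := ⟨fun _ _ h => ⟨h.1.symm, h.2.symm⟩⟩
  loopless := ⟨fun _ h => h.2 rfl⟩

/-! Lower bound: colour the edges by nonzero elements of a field of characteristic two with `q ≤ 2n`
elements so that every copy of `H` is rainbow. Send an edge set to its `k` odd power sums of
colours, the syndrome of a BCH code. Some fibre contains a proportion at least `q⁻ᵏ` of all graphs,
and two graphs in it differ by a set with zero syndrome, which by `not_forall_sum_odd_pow_eq_zero`
is not a nonempty rainbow set of at most `2k` edges.

Upper bound: take about `n` or `n/2` edges, all at one vertex or pairwise disjoint, so that every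
`2k`-subset of this set `E` is a copy of `H`. A code is then independent in the Cayley graph
generated by these subsets. Its degree has order `|E|^(2k)`, while its eigenvalues, which are
Krawtchouk values, are at least `-O(|E|^k)` by `neg_le_walshSum`. Hoffman's bound
`card_mul_choose_le_of_walshSum` gives density `O(|E|^(-k))`. -/

/-! ### BCH syndromes and rainbow differences -/

/-- In characteristic two, distinct nonzero elements are few-wise independent with respect to
their odd powers: this is the minimum distance of the BCH codes. -/
theorem not_forall_sum_odd_pow_eq_zero {α K : Type*} [Field K] [CharP K 2] {U : Finset α}
    {c : α → K} (hc : ∀ e ∈ U, c e ≠ 0) (hinj : Set.InjOn c U) (hne : U.Nonempty) {k : ℕ}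
    (hcard : U.card ≤ 2 * k) : ¬ ∀ j < k, ∑ e ∈ U, c e ^ (2 * j + 1) = 0 := by
  intro h
  have hpow : ∀ m, 1 ≤ m → m ≤ 2 * k → ∑ e ∈ U, c e ^ m = 0 := by
    intro m
    induction m using Nat.strong_induction_on with
    | _ m ih =>
      intro h1 h2
      rcases Nat.even_or_odd' m with ⟨j, rfl | rfl⟩
      · have hj := ih j (by omega) (by omega) (by omega)
        calc ∑ e ∈ U, c e ^ (2 * j) = ∑ e ∈ U, (c e ^ j) ^ 2 := by
              refine Finset.sum_congr rfl fun e _ => ?_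
              rw [← pow_mul, mul_comm]
          _ = 0 := by rw [← CharTwo.sum_sq, hj]; simp
      · exact h j (by omega)
  set g := U.equivFin
  -- The colours serve both as Vandermonde nodes and as the kernel vector, since `c * c ^ i = c ^ (i
  -- + 1)`.
  have hv : (fun i => c (g.symm i)) = (0 : Fin U.card → K) := by
    refine Matrix.eq_zero_of_forall_pow_sum_mul_pow_eq_zero (f := fun i => c (g.symm i)) ?_ ?_
    · intro i j hij
      exact g.symm.injective (Subtype.ext (hinj (g.symm i).2 (g.symm j).2 hij))
    · intro i
      have := hpow (i + 1) (by omega) (by omega)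
      rw [← Finset.sum_coe_sort, ← g.symm.sum_comp] at this
      simpa only [pow_succ'] using this
  obtain ⟨e, he⟩ := hne
  refine hc e he ?_
  simpa using congrFun hv (g ⟨e, he⟩)

/-- A colouring of the ground set by nonzero elements of a field of characteristic two gives a
large set system without nonempty rainbow symmetric differences of size at most `2 * k`. -/
theorem exists_large_setSystem_avoiding_rainbow {α K : Type*} [Fintype α] [DecidableEq α]
    [Field K] [Fintype K] [CharP K 2] {c : α → K} (hc : ∀ e, c e ≠ 0) (k : ℕ) :
    ∃ A : Finset (Finset α),
      (2 : ℝ) ^ Fintype.card α / (Fintype.card K : ℝ) ^ k ≤ A.card ∧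
      ∀ X ∈ A, ∀ Y ∈ A, (X ∆ Y).Nonempty → (X ∆ Y).card ≤ 2 * k →
        ¬ Set.InjOn c (X ∆ Y : Finset α) := by
  classical
  let Φ : Finset α → Fin k → K := fun X j => ∑ e ∈ X, c e ^ (2 * (j : ℕ) + 1)
  have hK : (0 : ℝ) < (Fintype.card K : ℝ) ^ k := by
    have : 0 < Fintype.card K := Fintype.card_pos
    positivity
  obtain ⟨y, hy⟩ := Fintype.exists_le_card_fiber_of_nsmul_le_card (M := ℝ)
    (b := (2 : ℝ) ^ Fintype.card α / (Fintype.card K : ℝ) ^ k) Φ (by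
      simp only [Fintype.card_fun, Fintype.card_fin, nsmul_eq_mul, Fintype.card_finset]
      push_cast
      rw [mul_div_cancel₀ _ hK.ne'])
  refine ⟨_, hy, ?_⟩
  intro X hX Y hY hne hcard hinj
  refine not_forall_sum_odd_pow_eq_zero (fun e _ => hc e) hinj hne hcard fun j hj => ?_
  have hX' := congrFun (Finset.mem_filter.1 hX).2 ⟨j, hj⟩
  have hY' := congrFun (Finset.mem_filter.1 hY).2 ⟨j, hj⟩
  have h1 : ∑ e ∈ X ∆ Y, c e ^ (2 * j + 1) =
      ∑ e ∈ X \ Y, c e ^ (2 * j + 1) + ∑ e ∈ Y \ X, c e ^ (2 * j + 1) :=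
    Finset.sum_union disjoint_sdiff_sdiff
  have h2 := Finset.sum_inter_add_sum_sdiff X Y fun e => c e ^ (2 * j + 1)
  have h3 := Finset.sum_inter_add_sum_sdiff Y X fun e => c e ^ (2 * j + 1)
  rw [Finset.inter_comm] at h3
  have h4 : ∑ e ∈ X, c e ^ (2 * j + 1) = ∑ e ∈ Y, c e ^ (2 * j + 1) := hX'.trans hY'.symm
  rw [← h2, ← h3] at h4
  rw [h1, add_left_cancel h4, CharTwo.add_self_eq_zero]

/-! ### Walsh characters and Hoffman's bound -/

/-- The Walsh character of the subset `S`. -/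
def walsh {α : Type*} [DecidableEq α] (S X : Finset α) : ℝ := (-1) ^ (S ∩ X).card

section Walsh
variable {α : Type*} [DecidableEq α]

theorem walsh_eq_prod (S X : Finset α) : walsh S X = ∏ e ∈ X, if e ∈ S then -1 else 1 := by
  rw [walsh, Finset.prod_ite, Finset.prod_const, Finset.prod_const_one, mul_one,
    Finset.filter_mem_eq_inter, Finset.inter_comm]

theorem walsh_comm (S X : Finset α) : walsh S X = walsh X S := by
  rw [walsh, walsh, Finset.inter_comm]

theorem walsh_symmDiff (S X Y : Finset α) : walsh S (X ∆ Y) = walsh S X * walsh S Y := by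
  have h1 : walsh S (X ∆ Y) = walsh S (X \ Y) * walsh S (Y \ X) := by
    simp only [walsh_eq_prod]
    exact Finset.prod_union disjoint_sdiff_sdiff
  have h (X Y : Finset α) : walsh S X = walsh S (X ∩ Y) * walsh S (X \ Y) := by
    simp only [walsh_eq_prod]
    exact (Finset.prod_inter_mul_prod_sdiff X Y _).symm
  have hsq : walsh S (X ∩ Y) * walsh S (X ∩ Y) = 1 := by
    rw [walsh, ← mul_pow]; simp
  rw [h X Y, h Y X, Finset.inter_comm Y X, h1]
  linear_combination -(walsh S (X \ Y) * walsh S (Y \ X)) * hsq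

theorem sum_walsh [Fintype α] (X : Finset α) :
    ∑ S, walsh S X = if X = ∅ then (2 : ℝ) ^ Fintype.card α else 0 := by
  have h : ∑ S, walsh S X = ∏ e : α, ((1 : ℝ) + if e ∈ X then -1 else 1) := by
    rw [Finset.prod_one_add, Finset.powerset_univ]
    exact Finset.sum_congr rfl fun S _ => by rw [walsh_comm, walsh_eq_prod]
  rw [h]
  split_ifs with hX
  · subst hX
    norm_num
  · obtain ⟨e, he⟩ := Finset.nonempty_iff_ne_empty.2 hX
    exact Finset.prod_eq_zero (Finset.mem_univ e) (by simp [he])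

/-- The unnormalized Walsh transform of the indicator function of a set system. -/
def walshTransform (A : Finset (Finset α)) (S : Finset α) : ℝ := ∑ X ∈ A, walsh S X

theorem sum_walshTransform_sq_mul_walsh [Fintype α] (A : Finset (Finset α)) (U : Finset α) :
    ∑ S, walshTransform A S ^ 2 * walsh S U =
      ∑ X ∈ A, ∑ Y ∈ A, if X ∆ Y = U then (2 : ℝ) ^ Fintype.card α else 0 := by
  have h (S : Finset α) : walshTransform A S ^ 2 * walsh S U =
      ∑ X ∈ A, ∑ Y ∈ A, walsh S ((X ∆ Y) ∆ U) := by
    simp only [walsh_symmDiff, ← Finset.sum_mul, sq, walshTransform, Finset.sum_mul_sum]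
  simp only [h]
  rw [Finset.sum_comm]
  refine Finset.sum_congr rfl fun X _ => ?_
  rw [Finset.sum_comm]
  refine Finset.sum_congr rfl fun Y _ => ?_
  rw [sum_walsh]
  congr 1
  exact propext symmDiff_eq_bot

theorem sum_walshTransform_sq [Fintype α] (A : Finset (Finset α)) :
    ∑ S, walshTransform A S ^ 2 = 2 ^ Fintype.card α * A.card := by
  have h := sum_walshTransform_sq_mul_walsh A ∅
  have h0 (S : Finset α) : walsh S ∅ = 1 := by simp [walsh]
  simp only [h0, mul_one] at h
  rw [h]
  have h1 (X Y : Finset α) : X ∆ Y = ∅ ↔ X = Y := symmDiff_eq_bot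
  simp only [h1]
  simp [mul_comm]

/-- The sum of a Walsh character over the `m`-subsets of `E`. -/
def walshSum (E : Finset α) (m : ℕ) (S : Finset α) : ℝ := ∑ U ∈ E.powersetCard m, walsh S U

/-- Hoffman's bound for the Cayley graph on subsets generated by the `m`-subsets of `E`. -/
theorem card_mul_choose_le_of_walshSum [Fintype α] {A : Finset (Finset α)} {E : Finset α}
    {m : ℕ} {B : ℝ} (hB : 0 ≤ B) (hE : ∀ S, -B ≤ walshSum E m S)
    (hA : ∀ X ∈ A, ∀ Y ∈ A, X ∆ Y ∉ E.powersetCard m) :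
    (A.card : ℝ) * E.card.choose m ≤ B * 2 ^ Fintype.card α := by
  have hzero : ∑ S, walshTransform A S ^ 2 * walshSum E m S = 0 := by
    simp only [walshSum, Finset.mul_sum]
    rw [Finset.sum_comm]
    refine Finset.sum_eq_zero fun U hU => ?_
    rw [sum_walshTransform_sq_mul_walsh]
    refine Finset.sum_eq_zero fun X hX => Finset.sum_eq_zero fun Y hY => if_neg ?_
    rintro rfl
    exact hA X hX Y hY hU
  have hempty : walshTransform A ∅ ^ 2 * (walshSum E m ∅ + B) =
      (A.card : ℝ) ^ 2 * (E.card.choose m + B) := by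
    simp [walshTransform, walshSum, walsh]
  -- Shifting the eigenvalues by `B` makes every summand nonnegative, so the trivial character alone
  -- is at most the whole sum.
  have hle : walshTransform A ∅ ^ 2 * (walshSum E m ∅ + B) ≤
      ∑ S, walshTransform A S ^ 2 * (walshSum E m S + B) :=
    Finset.single_le_sum (f := fun S => walshTransform A S ^ 2 * (walshSum E m S + B))
      (fun S _ => mul_nonneg (sq_nonneg _) (by linarith [hE S])) (Finset.mem_univ ∅)
  simp only [mul_add, Finset.sum_add_distrib] at hle
  rw [hzero, ← Finset.sum_mul, sum_walshTransform_sq, ← mul_add, hempty] at hle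
  rcases Nat.eq_zero_or_pos A.card with h0 | hpos
  · rw [h0]; simp; positivity
  · have hpos' : (0 : ℝ) < A.card := by exact_mod_cast hpos
    refine le_of_mul_le_mul_left ?_ hpos'
    nlinarith [mul_nonneg (sq_nonneg (A.card : ℝ)) hB]

end Walsh

/-! ### Lower bounds for Krawtchouk values -/

/-- Peel off `t 0`: the rest is minus an alternating sum in `[0, t 1]`. The upper bound is there to
drive the induction. -/
theorem alternating_sum_mem_Icc {t : ℕ → ℝ} {n : ℕ} (h0 : ∀ j, 0 ≤ t j)
    (ht : ∀ j, j + 1 < n → t (j + 1) ≤ t j) :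
    ∑ j ∈ Finset.range n, (-1) ^ j * t j ∈ Set.Icc 0 (t 0) := by
  induction n generalizing t with
  | zero => simpa using h0 0
  | succ n ih =>
    have h := ih (t := fun j => t (j + 1)) (fun j => h0 _) fun j hj => ht (j + 1) (by omega)
    have hs : ∑ j ∈ Finset.range n, (-1) ^ (j + 1) * t (j + 1) =
        -∑ j ∈ Finset.range n, (-1) ^ j * t (j + 1) := by
      rw [← Finset.sum_neg_distrib]
      exact Finset.sum_congr rfl fun j _ => by ring
    rw [Finset.sum_range_succ', hs]
    rcases Nat.eq_zero_or_pos n with rfl | hn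
    · simpa using h0 0
    · have h1 := ht 0 (by omega)
      constructor <;> simp at h h1 ⊢ <;> linarith [h.1, h.2]

/-- The Krawtchouk term with two more elements chosen among `s` dominates when `s` is large. -/
theorem choose_succ_mul_choose_le {b s j m : ℕ} (h : b * ((m + 2) * (m + 1)) ≤ (s - (m + 2)) ^ 2) :
    b.choose (j + 1) * s.choose m ≤ b.choose j * s.choose (m + 2) := by
  have h1 : b.choose (j + 1) ≤ b.choose j * b := by
    calc b.choose (j + 1) ≤ b.choose (j + 1) * (j + 1) := Nat.le_mul_of_pos_right _ (by omega)
      _ = b.choose j * (b - j) := Nat.choose_succ_right_eq b j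
      _ ≤ _ := Nat.mul_le_mul_left _ (Nat.sub_le _ _)
  have h2 : s.choose (m + 2) * ((m + 2) * (m + 1)) = s.choose m * ((s - m) * (s - (m + 1))) := by
    have e1 := Nat.choose_succ_right_eq s m
    have e2 := Nat.choose_succ_right_eq s (m + 1)
    calc _ = s.choose (m + 1 + 1) * (m + 1 + 1) * (m + 1) := by ring
      _ = s.choose (m + 1) * (m + 1) * (s - (m + 1)) := by rw [e2]; ring
      _ = _ := by rw [e1]; ring
  have h3 : s.choose m * b ≤ s.choose (m + 2) := by
    refine Nat.le_of_mul_le_mul_right ?_ (show 0 < (m + 2) * (m + 1) by positivity)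
    rw [h2, mul_assoc]
    refine Nat.mul_le_mul_left _ (h.trans ?_)
    rw [sq]
    exact Nat.mul_le_mul (by omega) (by omega)
  calc b.choose (j + 1) * s.choose m ≤ b.choose j * b * s.choose m := Nat.mul_le_mul_right _ h1
    _ = b.choose j * (s.choose m * b) := by ring
    _ ≤ _ := Nat.mul_le_mul_left _ h3

theorem neg_le_krawtchouk_sum {k b s N : ℕ} (hk : 1 ≤ k) (hb : b ≤ N) :
    -((k + 1) * (16 * k ^ 2) ^ k * (N : ℝ) ^ k) ≤
      ∑ j ∈ Finset.range (k + 1),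
        (-1) ^ j * ((b.choose j : ℝ) * (s.choose (2 * k - 2 * j) : ℝ)) := by
  -- Above this threshold, if `b > 0`, then `s ≥ 4k`, so `(s - 2k)² ≥ s²/4 ≥ 4k²N`. The terms then
  -- decrease and the alternating sum is nonnegative. Below it, each of the `k + 1` terms is `O(N ^
  -- k)`.
  by_cases hs : 16 * k ^ 2 * N ≤ s ^ 2
  · have hpos : 0 ≤ (k + 1) * (16 * k ^ 2) ^ k * (N : ℝ) ^ k := by positivity
    refine (neg_nonpos.2 hpos).trans (alternating_sum_mem_Icc (fun j => by positivity) ?_).1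
    intro j hj
    obtain ⟨m, hm⟩ : ∃ m, 2 * k - 2 * j = m + 2 := ⟨2 * k - 2 * j - 2, by omega⟩
    have hm' : 2 * k - 2 * (j + 1) = m := by omega
    rw [hm, hm']
    refine mod_cast choose_succ_mul_choose_le ?_
    rcases Nat.eq_zero_or_pos b with rfl | hb0
    · simp
    have h4 : 4 * k ≤ s := by
      refine (Nat.pow_le_pow_iff_left two_ne_zero).1 (le_trans ?_ hs)
      rw [mul_pow]
      exact Nat.le_mul_of_pos_right _ (hb0.trans_le hb)
    obtain ⟨r, rfl⟩ := Nat.exists_eq_add_of_le h4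
    have h5 : 2 * k + r ≤ 4 * k + r - (m + 2) := by omega
    calc b * ((m + 2) * (m + 1)) ≤ N * ((2 * k) * (2 * k)) :=
          Nat.mul_le_mul hb (Nat.mul_le_mul (by omega) (by omega))
      _ ≤ (2 * k + r) ^ 2 := by nlinarith
      _ ≤ _ := Nat.pow_le_pow_left h5 2
  · push Not at hs
    have hterm : ∀ j ∈ Finset.range (k + 1), -((16 * k ^ 2) ^ k * (N : ℝ) ^ k) ≤
        (-1) ^ j * ((b.choose j : ℝ) * (s.choose (2 * k - 2 * j) : ℝ)) := by
      intro j hj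
      have hj' : j ≤ k := by simpa [Nat.lt_succ_iff] using hj
      have h1 : b.choose j * s.choose (2 * k - 2 * j) ≤ (16 * k ^ 2) ^ k * N ^ k := by
        calc b.choose j * s.choose (2 * k - 2 * j) ≤ b ^ j * s ^ (2 * k - 2 * j) :=
              Nat.mul_le_mul (Nat.choose_le_pow _ _) (Nat.choose_le_pow _ _)
          _ = b ^ j * (s ^ 2) ^ (k - j) := by rw [← pow_mul, Nat.mul_sub]
          _ ≤ (16 * k ^ 2 * N) ^ j * (16 * k ^ 2 * N) ^ (k - j) := by
              gcongr
              exact hb.trans (Nat.le_mul_of_pos_left _ (by positivity))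
          _ = _ := by rw [← pow_add, Nat.add_sub_cancel' hj', mul_pow]
      have h2 : ((b.choose j : ℝ) * (s.choose (2 * k - 2 * j) : ℝ)) ≤
          (16 * k ^ 2) ^ k * (N : ℝ) ^ k := mod_cast h1
      have h3 : 0 ≤ ((b.choose j : ℝ) * (s.choose (2 * k - 2 * j) : ℝ)) := by positivity
      rcases neg_one_pow_eq_or ℝ j with h | h <;> rw [h] <;> linarith
    calc _ = ∑ j ∈ Finset.range (k + 1), -((16 * k ^ 2) ^ k * (N : ℝ) ^ k) := by
          rw [Finset.sum_const, Finset.card_range, nsmul_eq_mul]; push_cast; ring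
      _ ≤ _ := Finset.sum_le_sum hterm

-- Pairing the factors gives `(1 - X²)ᵇ (1 + X)ˢ`. The cancellation leaves only `k + 1` terms, each
-- of controlled size.
open Polynomial in
theorem coeff_one_sub_pow_mul_one_add_pow (b s k : ℕ) :
    ((1 - X : ℝ[X]) ^ b * (1 + X) ^ (b + s)).coeff (2 * k) =
      ∑ j ∈ Finset.range (k + 1),
        (-1) ^ j * ((b.choose j : ℝ) * (s.choose (2 * k - 2 * j) : ℝ)) := by
  have h1 : (1 - X : ℝ[X]) ^ b * (1 + X) ^ (b + s) =
      ∑ j ∈ Finset.range (b + 1), X ^ (2 * j) * (C ((-1) ^ j * (b.choose j : ℝ)) * (1 + X) ^ s) := by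
    rw [pow_add, ← mul_assoc, ← mul_pow,
      show (1 - X : ℝ[X]) * (1 + X) = -X ^ 2 + 1 by ring, add_pow, Finset.sum_mul]
    refine Finset.sum_congr rfl fun j _ => ?_
    rw [neg_pow, ← pow_mul]
    simp only [one_pow, map_mul, map_pow, map_neg, map_one, map_natCast]
    ring
  have h2 (j : ℕ) : (X ^ (2 * j) * (C ((-1) ^ j * (b.choose j : ℝ)) * (1 + X) ^ s)).coeff (2 * k) =
      if j < k + 1 then (-1) ^ j * ((b.choose j : ℝ) * (s.choose (2 * k - 2 * j) : ℝ)) else 0 := by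
    rw [coeff_X_pow_mul']
    by_cases h : j < k + 1
    · rw [if_pos (by omega), if_pos h, coeff_C_mul, coeff_one_add_X_pow, mul_assoc]
    · rw [if_neg (by omega), if_neg h]
  rw [h1, finsetSum_coeff]
  simp only [h2]
  rw [← Finset.sum_filter]
  refine Finset.sum_subset (fun j hj => by simp at hj ⊢; omega) fun j hj hj' => ?_
  have : b < j := by simp at hj hj'; omega
  simp [Nat.choose_eq_zero_of_lt this]

section
variable {α : Type*} [DecidableEq α]

-- The generating function of the character sums over subsets of `E` factors over the elements of
-- `E`.
open Polynomial in
theorem walshSum_eq_coeff (E S : Finset α) (m : ℕ) :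
    walshSum E m S = ((1 - X : ℝ[X]) ^ (E ∩ S).card * (1 + X) ^ (E \ S).card).coeff m := by
  have h : (1 - X : ℝ[X]) ^ (E ∩ S).card * (1 + X) ^ (E \ S).card =
      ∑ U ∈ E.powerset, C (walsh S U) * X ^ U.card := by
    calc _ = ∏ e ∈ E, (1 + C (if e ∈ S then (-1 : ℝ) else 1) * X) := by
          rw [← Finset.prod_inter_mul_prod_sdiff E S]
          congr 1
          · rw [Finset.prod_congr rfl (g := fun _ => (1 - X : ℝ[X])), Finset.prod_const]
            intro e he
            simp [(Finset.mem_inter.1 he).2, sub_eq_add_neg]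
          · rw [Finset.prod_congr rfl (g := fun _ => (1 + X : ℝ[X])), Finset.prod_const]
            intro e he
            simp [(Finset.mem_sdiff.1 he).2]
      _ = _ := by
          rw [Finset.prod_one_add]
          refine Finset.sum_congr rfl fun U _ => ?_
          rw [Finset.prod_mul_distrib, Finset.prod_const, walsh_eq_prod, map_prod]
  rw [h, finsetSum_coeff]
  simp only [coeff_C_mul_X_pow]
  rw [← Finset.sum_filter, walshSum, Finset.powersetCard_eq_filter]
  exact Finset.sum_congr (Finset.filter_congr fun _ _ => eq_comm) fun _ _ => rfl

theorem walshSum_compl_of_even [Fintype α] (E S : Finset α) (k : ℕ) :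
    walshSum E (2 * k) Sᶜ = walshSum E (2 * k) S := by
  refine Finset.sum_congr rfl fun U hU => ?_
  have h : walsh Sᶜ U = ∏ e ∈ U, -(if e ∈ S then (-1 : ℝ) else 1) := by
    rw [walsh_eq_prod]
    refine Finset.prod_congr rfl fun e _ => ?_
    by_cases he : e ∈ S <;> simp [he]
  rw [h, Finset.prod_neg, (Finset.mem_powersetCard.1 hU).2, walsh_eq_prod]
  simp

theorem neg_le_walshSum [Fintype α] (E S : Finset α) {k : ℕ} (hk : 1 ≤ k) :
    -((k + 1) * (16 * k ^ 2) ^ k * (E.card : ℝ) ^ k) ≤ walshSum E (2 * k) S := by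
  -- Since `2k` is even, complementing `S` keeps the sum and exchanges `E ∩ S` with `E \ S`.
  wlog h : (E ∩ S).card ≤ (E \ S).card generalizing S
  · rw [← walshSum_compl_of_even]
    refine this Sᶜ ?_
    have h1 : E \ Sᶜ = E ∩ S := by ext; simp
    have h2 : E ∩ Sᶜ = E \ S := by ext; simp
    rw [h1, h2]
    exact (not_le.1 h).le
  · obtain ⟨s, hs⟩ := Nat.exists_eq_add_of_le h
    rw [walshSum_eq_coeff, hs, coeff_one_sub_pow_mul_one_add_pow]
    exact neg_le_krawtchouk_sum hk (Finset.card_le_card Finset.inter_subset_left)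

end

/-- A set system none of whose symmetric differences is a `2 * k`-subset of the fixed set `E` has
density `O(1 / |E| ^ k)`. -/
theorem exists_bound_card_of_symmDiff_notMem {k : ℕ} (hk : 1 ≤ k) :
    ∃ C : ℝ, 0 < C ∧ ∀ (α : Type) [Fintype α] [DecidableEq α] (A : Finset (Finset α))
      (E : Finset α), (∀ X ∈ A, ∀ Y ∈ A, X ∆ Y ∉ E.powersetCard (2 * k)) →
        (A.card : ℝ) * ((E.card : ℝ) + 1) ^ k ≤ C * 2 ^ Fintype.card α := by
  have hk' : (1 : ℝ) ≤ k := by exact_mod_cast hk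
  set D : ℝ := (k + 1) * (16 * k ^ 2) ^ k
  have hD0 : 0 < D := by positivity
  -- The first summand covers small `E` trivially. In the second, `(2k)! 2^(2k)` comes from `choose
  -- N (2k) ≥ (N/2)^(2k) / (2k)!` and `2^k` from `N + 1 ≤ 2N`.
  refine ⟨(4 * k) ^ k + D * ((2 * k).factorial * 2 ^ (2 * k)) * 2 ^ k, by positivity, ?_⟩
  intro α _ _ A E hA
  have hnn : 0 ≤ D * ((2 * k).factorial * 2 ^ (2 * k)) * 2 ^ k * 2 ^ Fintype.card α := by positivity
  by_cases hN : E.card + 1 ≤ 4 * k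
  · have h1 : (A.card : ℝ) ≤ 2 ^ Fintype.card α := by
      have := A.card_le_univ
      rw [Fintype.card_finset] at this
      exact_mod_cast this
    have h2 : ((E.card : ℝ) + 1) ^ k ≤ (4 * k) ^ k := by
      gcongr
      exact_mod_cast hN
    calc (A.card : ℝ) * ((E.card : ℝ) + 1) ^ k ≤ 2 ^ Fintype.card α * (4 * k) ^ k := by gcongr
      _ ≤ _ := by linarith
  · set N := E.card with hNdef
    have hN4 : 4 * k ≤ N := by omega
    have hNpos : (0 : ℝ) < N := by
      have : 0 < N := by omega
      exact_mod_cast this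
    have hbound := card_mul_choose_le_of_walshSum (A := A) (E := E) (m := 2 * k)
      (B := D * (N : ℝ) ^ k) (by positivity) (fun S => neg_le_walshSum E S hk) hA
    rw [← hNdef] at hbound
    have hch : ((N : ℝ) / 2) ^ (2 * k) ≤ (2 * k).factorial * N.choose (2 * k) := by
      have h1 : ((N + 1 - 2 * k : ℕ) : ℝ) ^ (2 * k) ≤ (2 * k).factorial * N.choose (2 * k) := by
        exact_mod_cast Nat.pow_sub_le_descFactorial N (2 * k) |>.trans_eq
          (Nat.descFactorial_eq_factorial_mul_choose _ _)
      refine le_trans ?_ h1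
      gcongr
      rw [div_le_iff₀ (by norm_num)]
      exact_mod_cast (show N ≤ (N + 1 - 2 * k) * 2 by omega)
    have hmain : (A.card : ℝ) * (N : ℝ) ^ k ≤
        D * ((2 * k).factorial * 2 ^ (2 * k)) * 2 ^ Fintype.card α := by
      refine le_of_mul_le_mul_right ?_ (pow_pos hNpos k)
      calc (A.card : ℝ) * (N : ℝ) ^ k * (N : ℝ) ^ k
          = A.card * ((N : ℝ) / 2) ^ (2 * k) * 2 ^ (2 * k) := by
            rw [div_pow, mul_assoc, mul_assoc, div_mul_cancel₀ _ (by positivity), ← pow_add,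
              two_mul]
        _ ≤ A.card * ((2 * k).factorial * N.choose (2 * k)) * 2 ^ (2 * k) := by gcongr
        _ = (A.card * N.choose (2 * k)) * ((2 * k).factorial * 2 ^ (2 * k)) := by ring
        _ ≤ (D * (N : ℝ) ^ k * 2 ^ Fintype.card α) * ((2 * k).factorial * 2 ^ (2 * k)) := by gcongr
        _ = _ := by ring
    have h1 : ((N : ℝ) + 1) ^ k ≤ 2 ^ k * (N : ℝ) ^ k := by
      rw [← mul_pow]
      gcongr
      have : (1 : ℝ) ≤ N := by exact_mod_cast (show 1 ≤ N by omega)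
      linarith
    have h2 : (0 : ℝ) ≤ (4 * k) ^ k * 2 ^ Fintype.card α := by positivity
    calc (A.card : ℝ) * ((N : ℝ) + 1) ^ k ≤ A.card * (2 ^ k * (N : ℝ) ^ k) := by gcongr
      _ = (A.card * (N : ℝ) ^ k) * 2 ^ k := by ring
      _ ≤ D * ((2 * k).factorial * 2 ^ (2 * k)) * 2 ^ Fintype.card α * 2 ^ k := by gcongr
      _ ≤ _ := by linarith

/-! ### Graphs as edge sets, and transfer to graph codes -/

/-- The potential edges of a graph on `V`. -/
abbrev EdgeSlot (V : Type*) : Type _ := {e : Sym2 V // ¬ e.IsDiag}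

open Classical in
/-- A graph on a finite vertex set is the same as a finite set of edges. -/
noncomputable def edgesEquiv (V : Type*) [Fintype V] :
    SimpleGraph V ≃ Finset (EdgeSlot V) where
  toFun G := Finset.univ.filter fun e => e.1 ∈ G.edgeSet
  invFun U := SimpleGraph.fromEdgeSet ((↑) '' (U : Set (EdgeSlot V)))
  left_inv G := by
    ext u v
    simp only [SimpleGraph.fromEdgeSet_adj, Set.mem_image, Finset.coe_filter, Finset.mem_univ,
      true_and, Set.mem_ofPred_eq]
    constructor
    · rintro ⟨⟨e, he, h⟩, -⟩
      rw [h] at he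
      exact he
    · intro h
      exact ⟨⟨⟨s(u, v), by simpa using h.ne⟩, h, rfl⟩, h.ne⟩
  right_inv U := by
    ext ⟨e, he⟩
    simp only [SimpleGraph.edgeSet_fromEdgeSet, Finset.mem_filter, Finset.mem_univ, true_and,
      Set.mem_sdiff, Set.mem_image, Finset.mem_coe]
    constructor
    · rintro ⟨⟨e', h', rfl⟩, -⟩
      exact h'
    · exact fun h => ⟨⟨_, h, rfl⟩, he⟩

section
variable {V : Type*} [Fintype V]

theorem mem_edgesEquiv {G : SimpleGraph V} {e : EdgeSlot V} :
    e ∈ edgesEquiv V G ↔ e.1 ∈ G.edgeSet := by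
  simp [edgesEquiv]

theorem edgesEquiv_symmDiff [DecidableEq V] (G₁ G₂ : SimpleGraph V) :
    edgesEquiv V (G₁ ∆ G₂) = edgesEquiv V G₁ ∆ edgesEquiv V G₂ := by
  ext e
  rw [Finset.mem_symmDiff]
  simp only [mem_edgesEquiv, symmDiff_def, SimpleGraph.edgeSet_sup,
    SimpleGraph.edgeSet_sdiff, Set.mem_union, Set.mem_sdiff]

end

theorem card_edgeSlot_fin (n : ℕ) : Fintype.card (EdgeSlot (Fin n)) = n.choose 2 := by
  have := Sym2.card_subtype_not_diag (α := Fin n)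
  rw [Fintype.card_fin] at this
  rw [← this]

theorem exists_bound_graphCodeDensity {W : Type*} (H : SimpleGraph W) {k : ℕ} (hk : 1 ≤ k)
    (hE : ∀ n : ℕ, 1 ≤ n → ∃ E : Finset (EdgeSlot (Fin n)), n ≤ 2 * (E.card + 1) ∧
      ∀ U ∈ E.powersetCard (2 * k), (edgesEquiv (Fin n)).symm U ∈ graphCopies H (Fin n)) :
    ∃ C : ℝ, 0 < C ∧ ∀ n : ℕ, 1 ≤ n → graphCodeDensity H n ≤ C * (1 / (n : ℝ) ^ k) := by
  obtain ⟨C, hC, hbound⟩ := exists_bound_card_of_symmDiff_notMem hk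
  refine ⟨C * 2 ^ k, by positivity, fun n hn => ?_⟩
  obtain ⟨E, hnE, hcopy⟩ := hE n hn
  obtain ⟨F, hF, hcard⟩ := (isGreatest_maxGraphCode (graphCopies H (Fin n))).1
  have h := hbound (EdgeSlot (Fin n)) (F.map (edgesEquiv (Fin n)).toEmbedding) E (by
    intro X hX Y hY hU
    obtain ⟨G₁, h₁, rfl⟩ := Finset.mem_map.1 hX
    obtain ⟨G₂, h₂, rfl⟩ := Finset.mem_map.1 hY
    have hmem := hcopy _ hU
    simp only [Equiv.coe_toEmbedding] at hmem hU
    rw [← edgesEquiv_symmDiff, Equiv.symm_apply_apply] at hmem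
    refine hF G₁ h₁ G₂ h₂ ?_ hmem
    -- Equal graphs would have empty difference, but `U` has `2k > 0` elements.
    rintro rfl
    have := (Finset.mem_powersetCard.1 hU).2
    rw [symmDiff_self] at this
    simp at this
    omega)
  rw [Finset.card_map, hcard, card_edgeSlot_fin] at h
  have hn0 : (0 : ℝ) < (n : ℝ) ^ k := by positivity
  rw [graphCodeDensity, mul_one_div, div_le_div_iff₀ (by positivity) hn0]
  have h1 : (n : ℝ) ^ k ≤ 2 ^ k * ((E.card : ℝ) + 1) ^ k := by
    rw [← mul_pow]
    gcongr
    exact_mod_cast hnE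
  calc _ ≤ (maxGraphCode (graphCopies H (Fin n)) : ℝ) * (2 ^ k * ((E.card : ℝ) + 1) ^ k) := by
        gcongr
    _ = (maxGraphCode (graphCopies H (Fin n)) : ℝ) * ((E.card : ℝ) + 1) ^ k * 2 ^ k := by ring
    _ ≤ C * 2 ^ n.choose 2 * 2 ^ k := by gcongr
    _ = _ := by ring

theorem le_graphCodeDensity {W : Type*} (H : SimpleGraph W) {k : ℕ}
    (hc : ∀ (n : ℕ) (K : Type) [Field K] [CharP K 2] (ψ : Fin n → K), Function.Injective ψ →
      (∀ i, ψ i ≠ 0) → ∃ c : EdgeSlot (Fin n) → K, (∀ e, c e ≠ 0) ∧ ∀ f : W ↪ Fin n,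
        (edgesEquiv (Fin n) (H.map f)).Nonempty ∧ (edgesEquiv (Fin n) (H.map f)).card ≤ 2 * k ∧
        Set.InjOn c (edgesEquiv (Fin n) (H.map f))) :
    ∃ c : ℝ, 0 < c ∧ ∀ n : ℕ, 1 ≤ n → c * (1 / (n : ℝ) ^ k) ≤ graphCodeDensity H n := by
  refine ⟨1 / 2 ^ k, by positivity, fun n hn => ?_⟩
  -- With `n < 2 ^ s ≤ 2n` the field has `n` distinct nonzero labels, and replacing its order by
  -- `2n` costs the factor `1 / 2 ^ k`.
  set s := Nat.log 2 n + 1 with hs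
  have hlt : n < 2 ^ s := Nat.lt_pow_succ_log_self (by norm_num) n
  have hle : 2 ^ s ≤ 2 * n := by
    rw [hs, pow_succ, mul_comm]
    exact Nat.mul_le_mul_left _ (Nat.pow_log_le_self 2 (by omega))
  let K := GaloisField 2 s
  let _ : Fintype K := Fintype.ofFinite K
  have hcardK : Fintype.card K = 2 ^ s := by
    rw [← Nat.card_eq_fintype_card]
    exact GaloisField.card 2 s (by omega)
  obtain ⟨ψ⟩ : Nonempty (Fin n ↪ Kˣ) := by
    classical
    refine Function.Embedding.nonempty_of_card_le ?_
    rw [Fintype.card_units, hcardK, Fintype.card_fin]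
    omega
  obtain ⟨c, hc0, hcopy⟩ := hc n K (fun i => (ψ i : K))
    (fun i j h => ψ.injective (Units.ext h)) (fun i => (ψ i).ne_zero)
  obtain ⟨A, hAcard, hA⟩ := exists_large_setSystem_avoiding_rainbow hc0 k
  have hcode : IsGraphCode (graphCopies H (Fin n))
      (A.map (edgesEquiv (Fin n)).symm.toEmbedding) := by
    intro G₁ h₁ G₂ h₂ _ hG
    obtain ⟨X, hX, rfl⟩ := Finset.mem_map.1 h₁
    obtain ⟨Y, hY, rfl⟩ := Finset.mem_map.1 h₂
    obtain ⟨f, hf⟩ := hG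
    have h := hcopy f
    rw [← hf, edgesEquiv_symmDiff] at h
    simp only [Equiv.coe_toEmbedding, Equiv.apply_symm_apply] at h
    exact hA X hX Y hY h.1 h.2.1 h.2.2
  have hmax := (isGreatest_maxGraphCode (graphCopies H (Fin n))).2 ⟨_, hcode, rfl⟩
  rw [Finset.card_map] at hmax
  rw [card_edgeSlot_fin, hcardK] at hAcard
  have hn0 : (0 : ℝ) < n := by exact_mod_cast hn
  rw [graphCodeDensity, le_div_iff₀ (by positivity)]
  calc _ = (2 : ℝ) ^ n.choose 2 / (2 * n) ^ k := by rw [mul_pow]; field_simp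
    _ ≤ (2 : ℝ) ^ n.choose 2 / ((2 ^ s : ℕ) : ℝ) ^ k := by
        gcongr
        exact_mod_cast hle
    _ ≤ A.card := hAcard
    _ ≤ _ := by exact_mod_cast hmax

theorem injOn_image_univ_of_injective_comp {ι α β : Type*} [Fintype ι] [DecidableEq α]
    {e : ι → α} {c : α → β} (h : Function.Injective (c ∘ e)) :
    Set.InjOn c (Finset.univ.image e : Finset α) := by
  intro a ha b hb hab
  simp only [Finset.coe_image, Finset.coe_univ, Set.image_univ, Set.mem_range] at ha hb
  obtain ⟨i, rfl⟩ := ha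
  obtain ⟨j, rfl⟩ := hb
  rw [h hab]

/-- If all sub-tuples of an injective family of edges form copies of `H`, so do all subsets. -/
theorem exists_finset_powersetCard_copies {W : Type*} (H : SimpleGraph W) {n N t : ℕ}
    (h : Fin N ↪ EdgeSlot (Fin n))
    (hH : ∀ g : Fin t ↪ Fin N, ∃ f : W ↪ Fin n,
      edgesEquiv (Fin n) (H.map f) = Finset.univ.image fun i => h (g i)) :
    ∃ E : Finset (EdgeSlot (Fin n)), E.card = N ∧
      ∀ U ∈ E.powersetCard t, (edgesEquiv (Fin n)).symm U ∈ graphCopies H (Fin n) := by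
  refine ⟨Finset.univ.map h, by simp, fun U hU => ?_⟩
  obtain ⟨hUE, hUc⟩ := Finset.mem_powersetCard.1 hU
  obtain ⟨T, -, rfl⟩ := Finset.subset_map_iff.1 hUE
  rw [Finset.card_map] at hUc
  obtain ⟨f, hf⟩ := hH (T.orderEmbOfFin hUc).toEmbedding
  refine ⟨f, ?_⟩
  rw [Equiv.symm_apply_eq, hf]
  ext e
  have hT (x : Fin N) : x ∈ T ↔ ∃ i, T.orderEmbOfFin hUc i = x := by
    rw [← Finset.mem_coe, ← T.range_orderEmbOfFin hUc, Set.mem_range]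
  simp [hT]

/-! ### Stars and matchings: rainbow colourings and edge sets rich in copies -/

section Star
variable {V : Type*} {t : ℕ}

/-- The `i`-th edge of an embedded star. -/
def starSlot (f : Fin 1 ⊕ Fin t ↪ V) (i : Fin t) : EdgeSlot V :=
  ⟨s(f (.inl 0), f (.inr i)), by simp⟩

theorem edgesEquiv_map_starK [Fintype V] [DecidableEq V] (f : Fin 1 ⊕ Fin t ↪ V) :
    edgesEquiv V ((starK t).map f) = Finset.univ.image (starSlot f) := by
  ext ⟨e, he⟩
  induction e with | _ u v
  simp only [mem_edgesEquiv, SimpleGraph.mem_edgeSet, SimpleGraph.map_adj, starK,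
    Finset.mem_image, Finset.mem_univ, true_and, starSlot, Subtype.mk.injEq, Sym2.eq_iff]
  constructor
  · rintro ⟨a | a, b | b, h, rfl, rfl⟩
    · simp at h
    · exact ⟨b, Or.inl ⟨by rw [Subsingleton.elim a 0], rfl⟩⟩
    · exact ⟨a, Or.inr ⟨by rw [Subsingleton.elim b 0], rfl⟩⟩
    · simp at h
  · rintro ⟨i, ⟨rfl, rfl⟩ | ⟨rfl, rfl⟩⟩
    · exact ⟨.inl 0, .inr i, by simp, rfl, rfl⟩
    · exact ⟨.inr i, .inl 0, by simp, rfl, rfl⟩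

/-- The edge colouring of a complete graph by sums of the labels of the end vertices. -/
def sumColor {K : Type*} [AddCommMonoid K] (ψ : V → K) (e : EdgeSlot V) : K :=
  Sym2.lift ⟨fun u v => ψ u + ψ v, fun _ _ => add_comm _ _⟩ e.1

end Star

section Matching
variable {V : Type*} {t : ℕ}

/-- The `i`-th edge of an embedded matching. -/
def matchingSlot (f : Fin t × Fin 2 ↪ V) (i : Fin t) : EdgeSlot V :=
  ⟨s(f (i, 0), f (i, 1)), by simp⟩

theorem edgesEquiv_map_matchingM [Fintype V] [DecidableEq V] (f : Fin t × Fin 2 ↪ V) :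
    edgesEquiv V ((matchingM t).map f) = Finset.univ.image (matchingSlot f) := by
  ext ⟨e, he⟩
  induction e with | _ u v
  simp only [mem_edgesEquiv, SimpleGraph.mem_edgeSet, SimpleGraph.map_adj, matchingM,
    Finset.mem_image, Finset.mem_univ, true_and, matchingSlot, Subtype.mk.injEq, Sym2.eq_iff]
  constructor
  · rintro ⟨⟨i, a⟩, ⟨j, b⟩, ⟨h, hab⟩, rfl, rfl⟩
    obtain rfl : i = j := h
    refine ⟨i, ?_⟩
    fin_cases a <;> fin_cases b <;> simp at hab ⊢
  · rintro ⟨i, ⟨rfl, rfl⟩ | ⟨rfl, rfl⟩⟩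
    · exact ⟨(i, 0), (i, 1), ⟨rfl, by simp⟩, rfl, rfl⟩
    · exact ⟨(i, 1), (i, 0), ⟨rfl, by simp⟩, rfl, rfl⟩

end Matching

theorem exists_rainbow_coloring_star {k : ℕ} (hk : 1 ≤ k) (n : ℕ) (K : Type) [Field K] [CharP K 2]
    (ψ : Fin n → K) (hψ : Function.Injective ψ) :
    ∃ c : EdgeSlot (Fin n) → K, (∀ e, c e ≠ 0) ∧ ∀ f : Fin 1 ⊕ Fin (2 * k) ↪ Fin n,
      (edgesEquiv (Fin n) ((starK (2 * k)).map f)).Nonempty ∧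
      (edgesEquiv (Fin n) ((starK (2 * k)).map f)).card ≤ 2 * k ∧
      Set.InjOn c (edgesEquiv (Fin n) ((starK (2 * k)).map f)) := by
  -- Edges with a common centre are told apart by the labels of their leaves. In characteristic two,
  -- `ψ u + ψ v = 0` would force `u = v`.
  refine ⟨sumColor ψ, ?_, fun f => ?_⟩
  · rintro ⟨e, he⟩
    induction e with | _ u v
    intro h
    exact he (hψ (CharTwo.add_eq_zero.1 h))
  · rw [edgesEquiv_map_starK]
    refine ⟨⟨_, Finset.mem_image_of_mem _ (Finset.mem_univ ⟨0, by omega⟩)⟩,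
      Finset.card_image_le.trans (by simp), injOn_image_univ_of_injective_comp fun i j h => ?_⟩
    exact Sum.inr_injective (f.injective (hψ (add_left_cancel h)))

theorem exists_rainbow_coloring_matching {k : ℕ} (hk : 1 ≤ k) (n : ℕ) (K : Type) [Field K]
    (ψ : Fin n → K) (hψ : Function.Injective ψ) (h0 : ∀ i, ψ i ≠ 0) :
    ∃ c : EdgeSlot (Fin n) → K, (∀ e, c e ≠ 0) ∧ ∀ f : Fin (2 * k) × Fin 2 ↪ Fin n,
      (edgesEquiv (Fin n) ((matchingM (2 * k)).map f)).Nonempty ∧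
      (edgesEquiv (Fin n) ((matchingM (2 * k)).map f)).card ≤ 2 * k ∧
      Set.InjOn c (edgesEquiv (Fin n) ((matchingM (2 * k)).map f)) := by
  -- Disjoint edges have different smaller endpoints, whereas sums of labels could coincide on them.
  refine ⟨fun e => ψ e.1.inf, fun e => h0 _, fun f => ?_⟩
  rw [edgesEquiv_map_matchingM]
  refine ⟨⟨_, Finset.mem_image_of_mem _ (Finset.mem_univ ⟨0, by omega⟩)⟩,
    Finset.card_image_le.trans (by simp), injOn_image_univ_of_injective_comp fun i j h => ?_⟩
  have h' : f (i, 0) ⊓ f (i, 1) = f (j, 0) ⊓ f (j, 1) := hψ h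
  rcases min_choice (f (i, 0)) (f (i, 1)) with h1 | h1 <;>
    rcases min_choice (f (j, 0)) (f (j, 1)) with h2 | h2 <;>
    rw [h1, h2] at h' <;> exact congrArg Prod.fst (f.injective h')

theorem exists_finset_star_copies (t n : ℕ) (hn : 1 ≤ n) :
    ∃ E : Finset (EdgeSlot (Fin n)), n ≤ 2 * (E.card + 1) ∧
      ∀ U ∈ E.powersetCard t, (edgesEquiv (Fin n)).symm U ∈ graphCopies (starK t) (Fin n) := by
  obtain ⟨N, rfl⟩ : ∃ N, n = N + 1 := ⟨n - 1, by omega⟩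
  let h : Fin N ↪ EdgeSlot (Fin (N + 1)) :=
    ⟨fun i => ⟨s(0, i.succ), by simpa using (Fin.succ_ne_zero i).symm⟩, fun i j hij => by
      simpa [Fin.succ_ne_zero, Sym2.eq_iff] using hij⟩
  obtain ⟨E, hE, hU⟩ := exists_finset_powersetCard_copies (starK t) h fun g =>
    ⟨⟨Sum.elim (fun _ => 0) fun i => (g i).succ, by
      rintro (a | a) (b | b) hab
      · rw [Subsingleton.elim a b]
      · exact absurd hab.symm (Fin.succ_ne_zero _)
      · exact absurd hab (Fin.succ_ne_zero _)
      · rw [g.injective (Fin.succ_injective _ hab)]⟩, edgesEquiv_map_starK _⟩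
  exact ⟨E, by omega, hU⟩

theorem exists_finset_matching_copies (t n : ℕ) :
    ∃ E : Finset (EdgeSlot (Fin n)), n ≤ 2 * (E.card + 1) ∧
      ∀ U ∈ E.powersetCard t, (edgesEquiv (Fin n)).symm U ∈ graphCopies (matchingM t) (Fin n) := by
  -- Vertices are paired as `2i`, `2i + 1`; for odd `n` the last one is left out, which `n ≤ 2 *
  -- (E.card + 1)` allows.
  let p : Fin (n / 2) × Fin 2 ↪ Fin n :=
    finProdFinEquiv.toEmbedding.trans (Fin.castLEEmb (Nat.div_mul_le_self n 2))
  let h : Fin (n / 2) ↪ EdgeSlot (Fin n) :=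
    ⟨matchingSlot p, fun i j hij => by
      have := congrArg Subtype.val hij
      simpa [matchingSlot, Sym2.eq_iff] using this⟩
  obtain ⟨E, hE, hU⟩ := exists_finset_powersetCard_copies (matchingM t) h fun g =>
    ⟨(g.prodMap (Function.Embedding.refl (Fin 2))).trans p, edgesEquiv_map_matchingM _⟩
  exact ⟨E, by omega, hU⟩

/-- For every positive integer `k`, both `d_{K_{1,2k}}(n)` and `d_{M_{2k}}(n)` are
`Θ_k(1 / n ^ k)`: the constants depend on `k` only. -/
theorem theoremt11 (k : ℕ) (hk : 1 ≤ k) :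
    (∃ c C : ℝ, 0 < c ∧ 0 < C ∧ ∀ n : ℕ, 1 ≤ n →
      c * (1 / (n : ℝ) ^ k) ≤ graphCodeDensity (starK (2 * k)) n ∧
      graphCodeDensity (starK (2 * k)) n ≤ C * (1 / (n : ℝ) ^ k)) ∧
    (∃ c C : ℝ, 0 < c ∧ 0 < C ∧ ∀ n : ℕ, 1 ≤ n →
      c * (1 / (n : ℝ) ^ k) ≤ graphCodeDensity (matchingM (2 * k)) n ∧
      graphCodeDensity (matchingM (2 * k)) n ≤ C * (1 / (n : ℝ) ^ k)) := by
  constructor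
  · obtain ⟨c, hc, hlow⟩ := le_graphCodeDensity (starK (2 * k)) (k := k)
      fun n K _ _ ψ hψ _ => exists_rainbow_coloring_star hk n K ψ hψ
    obtain ⟨C, hC, hup⟩ := exists_bound_graphCodeDensity (starK (2 * k)) hk
      (exists_finset_star_copies (2 * k))
    exact ⟨c, C, hc, hC, fun n hn => ⟨hlow n hn, hup n hn⟩⟩
  · obtain ⟨c, hc, hlow⟩ := le_graphCodeDensity (matchingM (2 * k)) (k := k)
      fun n K _ _ ψ hψ h0 => exists_rainbow_coloring_matching hk n K ψ hψ h0
    obtain ⟨C, hC, hup⟩ := exists_bound_graphCodeDensity (matchingM (2 * k)) hk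
      fun n _ => exists_finset_matching_copies (2 * k) n
    exact ⟨c, C, hc, hC, fun n hn => ⟨hlow n hn, hup n hn⟩⟩
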